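/- A loop is a set $Q$ with a binary operation and a two-sided neutral element such that all left translations $L_x\colon y\mapsto xy$ and all right translations $R_x\colon y\mapsto yx$ are bijections of $Q$. Its inner mapping group $\mathrm{Inn}(Q)$ is the permutation group generated by the maps $L_{yx}^{-1}L_yL_x$, $R_{xy}^{-1}R_yR_x$ and $L_x^{-1}R_x$ for $x,y\in Q$ (maps are composed from right to left). The loop $Q$ is an automorphic loop (A-loop) if every inner mapping of $Q$ is an automorphism of $Q$. The middle nucleus of $Q$ is $N_\mu(Q)=\{y\in Q : (xy)z=x(yz)\text{ for all }x,z\in Q\}$. Lemma. Let $k\ge \ell>0$ be integers and let $d=k-\ell$. Then there is a nonassociative commutative A-loop of order $2^k$ with middle nucleus of order $2^\ell$ if and only if either $d\ge 3$, or $d\ge 1$ and $\ell\ge 2$. -/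

import Mathlib

universe u

/-- A loop: a set with a binary operation and a two-sided neutral element, all of whose left
and right translations are bijections. -/
class Loop (Q : Type u) extends Mul Q, One Q where
  protected one_mul : ∀ x : Q, 1 * x = x
  protected mul_one : ∀ x : Q, x * 1 = x
  bijective_mul_left : ∀ x : Q, Function.Bijective fun y : Q => x * y
  bijective_mul_right : ∀ x : Q, Function.Bijective fun y : Q => y * x

namespace Loop

/-- The left translation `L_x : y ↦ x * y`. -/
noncomputable def leftTranslation {Q : Type u} [Loop Q] (x : Q) : Equiv.Perm Q :=
  Equiv.ofBijective (fun y : Q => x * y) (bijective_mul_left x)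

/-- The right translation `R_x : y ↦ y * x`. -/
noncomputable def rightTranslation {Q : Type u} [Loop Q] (x : Q) : Equiv.Perm Q :=
  Equiv.ofBijective (fun y : Q => y * x) (bijective_mul_right x)

/-- `L_{x,y} = L_{yx}⁻¹ L_y L_x`; a product of permutations is applied from right to left. -/
noncomputable def leftInner {Q : Type u} [Loop Q] (x y : Q) : Equiv.Perm Q :=
  (leftTranslation (y * x))⁻¹ * leftTranslation y * leftTranslation x

/-- `R_{x,y} = R_{xy}⁻¹ R_y R_x`. -/
noncomputable def rightInner {Q : Type u} [Loop Q] (x y : Q) : Equiv.Perm Q :=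
  (rightTranslation (x * y))⁻¹ * rightTranslation y * rightTranslation x

/-- `T_x = L_x⁻¹ R_x`. -/
noncomputable def middleInner {Q : Type u} [Loop Q] (x : Q) : Equiv.Perm Q :=
  (leftTranslation x)⁻¹ * rightTranslation x

/-- The inner mapping group `Inn(Q)`. -/
def innerMappingGroup (Q : Type u) [Loop Q] : Subgroup (Equiv.Perm Q) :=
  Subgroup.closure
    ({φ | ∃ x y : Q, φ = leftInner x y} ∪ {φ | ∃ x y : Q, φ = rightInner x y} ∪
      {φ | ∃ x : Q, φ = middleInner x})

/-- An automorphic loop (A-loop): `Inn(Q) ≤ Aut(Q)` inside the symmetric group on `Q`. -/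
def IsAutomorphic (Q : Type u) [Loop Q] : Prop :=
  innerMappingGroup Q ≤ (MulAut.toPerm Q).range

/-- The loop operation is commutative. -/
def IsCommutative (Q : Type u) [Loop Q] : Prop :=
  ∀ x y : Q, x * y = y * x

/-- The loop operation is associative. -/
def IsAssociative (Q : Type u) [Loop Q] : Prop :=
  ∀ x y z : Q, (x * y) * z = x * (y * z)

/-- The middle nucleus `N_μ(Q)`. -/
def middleNucleus (Q : Type u) [Loop Q] : Set Q :=
  {y | ∀ x z : Q, (x * y) * z = x * (y * z)}

end Loop

/-! The excluded cases are `k = l`, where the middle nucleus is everything, and `l = 1` with order 4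
or 8. When `l = 1`, inner mappings are automorphisms, so they preserve the middle nucleus `{1, n}`
and fix `n`, which is therefore a central involution. Fixed points of `leftInner x y` are closed
under products, so associativity need only be tested on generators modulo `n`. In order 4 this is
flexibility. In order 8, generated by `a`, `b`, `n`, the products `(ab)(ab)`, `(b(ab))a` and
`((ab)a)b` agree modulo `n`, so two of them coincide, and each coincidence puts one of `a`, `b`,
`ab` into the middle nucleus.

The examples are central extensions of 𝔽₂ᵐ by 𝔽₂ⁿ with a symmetric cocycle whose associator is
additive in its last argument, which makes inner mappings automorphisms. The middle nucleus is the
preimage of the radical of the associator in its middle argument, and the vectors `c i` control that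
radical. -/

namespace Loop

/-! ### Inner mappings, associating triples and the middle nucleus -/

section General

variable {Q : Type u} [Loop Q]

theorem mem_range_toPerm_of_map_mul (φ : Equiv.Perm Q) (h : ∀ x y, φ (x * y) = φ x * φ y) :
    φ ∈ (MulAut.toPerm Q).range :=
  ⟨{ φ with map_mul' := h }, rfl⟩

theorem leftTranslation_apply (x y : Q) : leftTranslation x y = x * y := rfl

theorem leftInner_spec (x y z : Q) : (y * x) * leftInner x y z = y * (x * z) := by
  rw [← leftTranslation_apply (y * x)]
  simp [leftInner, leftTranslation_apply]

theorem mul_left_cancel {x y z : Q} (h : x * y = x * z) : y = z :=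
  (bijective_mul_left x).1 h

theorem rightTranslation_eq_leftTranslation (hc : IsCommutative Q) (x : Q) :
    rightTranslation x = leftTranslation x :=
  Equiv.ext fun y => hc y x

/-- Commutativity gives `R_x = L_x`, so only the generators `L_{x,y}` remain to be checked. -/
theorem isAutomorphic_of_commutative (hc : IsCommutative Q)
    (h : ∀ x y z w : Q, leftInner x y (z * w) = leftInner x y z * leftInner x y w) :
    IsAutomorphic Q := by
  refine (Subgroup.closure_le _).2 ?_
  rintro φ ((⟨x, y, rfl⟩ | ⟨x, y, rfl⟩) | ⟨x, rfl⟩)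
  · exact mem_range_toPerm_of_map_mul _ (h x y)
  · have : rightInner x y = leftInner x y := by
      simp only [rightInner, leftInner, rightTranslation_eq_leftTranslation hc, hc x y]
    rw [SetLike.mem_coe, this]
    exact mem_range_toPerm_of_map_mul _ (h x y)
  · have : middleInner x = 1 := by
      simp [middleInner, rightTranslation_eq_leftTranslation hc]
    rw [SetLike.mem_coe, this]
    exact one_mem _

theorem IsAutomorphic.leftInner_mul (h : IsAutomorphic Q) (x y z w : Q) :
    leftInner x y (z * w) = leftInner x y z * leftInner x y w := by
  obtain ⟨e, he⟩ := h (Subgroup.subset_closure (Or.inl (Or.inl ⟨x, y, rfl⟩)) :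
    leftInner x y ∈ innerMappingGroup Q)
  rw [← he]
  exact map_mul e z w

/-- The elements that associate with `y` and `x` on the right are the fixed points of
`L_{x,y}`. -/
theorem leftInner_eq_self_iff {x y z : Q} : leftInner x y z = z ↔ (y * x) * z = y * (x * z) := by
  rw [← leftInner_spec]
  exact ⟨fun h => by rw [h], fun h => (mul_left_cancel h).symm⟩

theorem map_mem_middleNucleus {φ : Equiv.Perm Q} (h : ∀ x y, φ (x * y) = φ x * φ y) {y : Q}
    (hy : y ∈ middleNucleus Q) : φ y ∈ middleNucleus Q := by
  intro x z
  obtain ⟨x, rfl⟩ := φ.surjective x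
  obtain ⟨z, rfl⟩ := φ.surjective z
  simp only [← h, hy x z]

theorem one_mem_middleNucleus : (1 : Q) ∈ middleNucleus Q := fun x z => by
  rw [Loop.mul_one, Loop.one_mul]

theorem isAssociative_iff_middleNucleus : IsAssociative Q ↔ middleNucleus Q = Set.univ :=
  ⟨fun h => Set.eq_univ_of_forall fun y x z => h x y z,
    fun h x y z => (h ▸ Set.mem_univ y : y ∈ middleNucleus Q) x z⟩

end General

/-! ### Middle nucleus of order two: orders 4 and 8 are associative -/

section SmallMiddleNucleus

variable {Q : Type u} [Loop Q]

theorem IsAutomorphic.associates_mul (ha : IsAutomorphic Q) {x y z w : Q}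
    (hz : (y * x) * z = y * (x * z)) (hw : (y * x) * w = y * (x * w)) :
    (y * x) * (z * w) = y * (x * (z * w)) := by
  rw [← leftInner_eq_self_iff] at *
  rw [ha.leftInner_mul, hz, hw]

theorem IsAutomorphic.associates_of_mul (ha : IsAutomorphic Q) {x y z w : Q}
    (hz : (y * x) * z = y * (x * z)) (hw : (y * x) * (z * w) = y * (x * (z * w))) :
    (y * x) * w = y * (x * w) := by
  rw [← leftInner_eq_self_iff] at *
  rw [ha.leftInner_mul, hz] at hw
  exact mul_left_cancel hw

theorem IsCommutative.flexible (hc : IsCommutative Q) (x y : Q) :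
    (y * x) * y = y * (x * y) := by
  rw [hc (y * x), hc y x]

theorem IsCommutative.associates_symm (hc : IsCommutative Q) {x y z : Q}
    (h : (y * x) * z = y * (x * z)) : (z * x) * y = z * (x * y) := by
  rw [hc z x, hc _ y, ← h, hc y x, hc _ z]

/-- A central involution: the data carried by a middle nucleus of order two. -/
structure IsCentralInvolution (n : Q) : Prop where
  ne_one : n ≠ 1
  mul_self : n * n = 1
  left : ∀ x y : Q, (n * x) * y = n * (x * y)
  right : ∀ x y : Q, x * (n * y) = n * (x * y)

theorem exists_isCentralInvolution (hc : IsCommutative Q) (ha : IsAutomorphic Q)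
    (h : Nat.card (middleNucleus Q) = 2) :
    ∃ n : Q, IsCentralInvolution n ∧ ∀ y ∈ middleNucleus Q, y = 1 ∨ y = n := by
  rw [Nat.card_coe_set_eq, Set.ncard_eq_two] at h
  obtain ⟨p, q, hpq, h⟩ := h
  obtain ⟨n, hn, hN⟩ : ∃ n : Q, n ≠ 1 ∧ middleNucleus Q = {1, n} := by
    have h1 := one_mem_middleNucleus (Q := Q)
    rw [h] at h1
    rcases h1 with rfl | h1
    · exact ⟨q, hpq.symm, h⟩
    · rw [Set.mem_singleton_iff] at h1
      subst h1
      exact ⟨p, hpq, by rw [h, Set.pair_comm]⟩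
  have hnN : n ∈ middleNucleus Q := by simp [hN]
  -- Each `leftInner x y` maps `{1, n}` into itself and fixes `1`, hence fixes `n`.
  have key : ∀ x y : Q, (y * x) * n = y * (x * n) := by
    intro x y
    rw [← leftInner_eq_self_iff]
    have := map_mem_middleNucleus (ha.leftInner_mul x y) hnN
    rw [hN] at this
    rcases this with h1 | h1
    · have h4 : leftInner x y 1 = 1 := by
        rw [leftInner_eq_self_iff, Loop.mul_one, Loop.mul_one]
      exact absurd ((leftInner x y).injective (h1.trans h4.symm)) hn
    · exact h1
  have left : ∀ x y : Q, (n * x) * y = n * (x * y) := fun x y => by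
    rw [hc n x, hnN x y, hc n y, ← key, hc]
  have right : ∀ x y : Q, x * (n * y) = n * (x * y) := fun x y => by
    rw [← hnN x y, hc x n, left]
  have hsq : n * n ∈ middleNucleus Q := fun x z => by
    rw [left, right, right, left, hnN]
  rw [hN] at hsq
  refine ⟨n, ⟨hn, ?_, left, right⟩, fun y hy => by simpa [hN] using hy⟩
  rcases hsq with h1 | h1
  · exact h1
  · exact absurd (mul_left_cancel (h1.trans (Loop.mul_one n).symm)) hn

/-- Congruence modulo the subloop `{1, n}`. -/
def ModEq (n x y : Q) : Prop := x = y ∨ x = n * y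

namespace IsCentralInvolution

variable {n : Q}

theorem mul_mul_self (hn : IsCentralInvolution n) (x : Q) : n * (n * x) = x := by
  rw [← hn.left, hn.mul_self, Loop.one_mul]

theorem mul_ne_self (hn : IsCentralInvolution n) (x : Q) : n * x ≠ x := fun h =>
  hn.ne_one ((bijective_mul_right x).1 (h.trans (Loop.one_mul x).symm))

theorem modEq_symm (hn : IsCentralInvolution n) {x y : Q} (h : ModEq n x y) : ModEq n y x := by
  rcases h with rfl | rfl
  · exact Or.inl rfl
  · exact Or.inr (hn.mul_mul_self y).symm

theorem modEq_trans (hn : IsCentralInvolution n) {x y z : Q} (h : ModEq n x y)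
    (h' : ModEq n y z) : ModEq n x z := by
  rcases h with rfl | rfl
  · exact h'
  · rcases h' with rfl | rfl
    · exact Or.inr rfl
    · exact Or.inl (hn.mul_mul_self z)

theorem modEq_mul (hn : IsCentralInvolution n) {x y z w : Q} (h : ModEq n x y)
    (h' : ModEq n z w) : ModEq n (x * z) (y * w) := by
  rcases h with rfl | rfl <;> rcases h' with rfl | rfl
  · exact Or.inl rfl
  · exact Or.inr (hn.right _ _)
  · exact Or.inr (hn.left _ _)
  · exact Or.inl (by rw [hn.left, hn.right, hn.mul_mul_self])

theorem modEq_cancel (hn : IsCentralInvolution n) {x y z : Q} (h : ModEq n (x * y) (x * z)) :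
    ModEq n y z := by
  rcases h with h | h
  · exact Or.inl (mul_left_cancel h)
  · exact Or.inr (mul_left_cancel (h.trans (hn.right x z).symm))

open Classical in
theorem card_union_image (hn : IsCentralInvolution n) (S : Finset Q)
    (hS : ∀ x ∈ S, ∀ y ∈ S, ModEq n x y → x = y) :
    (S ∪ S.image (n * ·)).card = 2 * S.card := by
  rw [Finset.card_union_of_disjoint, Finset.card_image_of_injective _ (bijective_mul_left n).1,
    two_mul]
  rw [Finset.disjoint_left]
  intro x hx hx'
  obtain ⟨y, hy, rfl⟩ := Finset.mem_image.1 hx'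
  exact hn.mul_ne_self y (hS _ hx y hy (Or.inr rfl))

open Classical in
theorem mem_union_image {S : Finset Q} {q : Q} :
    q ∈ S ∪ S.image (n * ·) ↔ ∃ s ∈ S, ModEq n q s := by
  simp only [Finset.mem_union, Finset.mem_image, ModEq]
  grind

theorem exists_not_modEq (n : Q) [Finite Q] (S : Finset Q)
    (hS : 2 * S.card < Nat.card Q) : ∃ q : Q, ∀ s ∈ S, ¬ ModEq n q s := by
  classical
  by_contra! h
  have := Fintype.ofFinite Q
  have h1 : S ∪ S.image (n * ·) = Finset.univ :=
    Finset.eq_univ_of_forall fun q => mem_union_image.2 (h q)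
  have h2 := Finset.card_union_le S (S.image (n * ·))
  have h3 : (S.image (n * ·)).card ≤ S.card := Finset.card_image_le
  rw [h1, Finset.card_univ, ← Nat.card_eq_fintype_card] at h2
  omega

theorem exists_modEq (hn : IsCentralInvolution n) [Finite Q] (S : Finset Q)
    (hS : ∀ x ∈ S, ∀ y ∈ S, ModEq n x y → x = y) (hc : 2 * S.card = Nat.card Q) (q : Q) :
    ∃ s ∈ S, ModEq n q s := by
  classical
  have := Fintype.ofFinite Q
  rw [← mem_union_image, Finset.eq_univ_of_card (S ∪ S.image (n * ·))]
  · exact Finset.mem_univ q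
  · rw [hn.card_union_image S hS, hc, Nat.card_eq_fintype_card]

theorem associates_of_modEq (hn : IsCentralInvolution n) {x y z w : Q} (h : ModEq n z w)
    (hw : (y * x) * w = y * (x * w)) : (y * x) * z = y * (x * z) := by
  rcases h with rfl | rfl
  · exact hw
  · rw [hn.right, hn.right, hn.right, hw]

/-- A commutative A-loop of order four with a central involution is associative. -/
theorem isAssociative_of_card_eq_four (hn : IsCentralInvolution n) (hc : IsCommutative Q)
    (hQ : Nat.card Q = 4) : IsAssociative Q := by
  have : Finite Q := Nat.finite_of_card_ne_zero (by omega)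
  have hone : ∀ x y : Q, (y * x) * 1 = y * (x * 1) := fun x y => by
    rw [Loop.mul_one, Loop.mul_one]
  intro y x z
  by_cases hz : ModEq n z 1
  · exact hn.associates_of_modEq hz (hone x y)
  by_cases hy : ModEq n y 1
  · exact hc.associates_symm (hn.associates_of_modEq hy (hone x z))
  -- There are only two classes modulo `n`, so `z` and `y` share the nontrivial one and flexibility
  -- applies.
  have hzy : ModEq n z y := by
    classical
    obtain ⟨s, hs, h⟩ := hn.exists_modEq {1, y}
      (by
        have hy' : ¬ ModEq n 1 y := fun h => hy (hn.modEq_symm h)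
        simp [hy, hy'])
      (by
        rw [Finset.card_pair fun h => hy (Or.inl h.symm), hQ]) z
    rw [Finset.mem_insert, Finset.mem_singleton] at hs
    rcases hs with rfl | rfl
    · exact absurd h hz
    · exact h
  exact hn.associates_of_modEq hzy (hc.flexible x y)

/-- In a commutative A-loop generated by a central involution `n` together with `a` and `b`,
an element associating in the middle with `a` and `b` lies in the middle nucleus. -/
theorem mem_middleNucleus_of_associates (hn : IsCentralInvolution n) (hc : IsCommutative Q)
    (ha : IsAutomorphic Q) {a b x : Q}
    (hQ : ∀ q, ModEq n q 1 ∨ ModEq n q a ∨ ModEq n q b ∨ ModEq n q (a * b))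
    (h : (a * x) * b = a * (x * b)) : x ∈ middleNucleus Q := by
  -- The `z` with `(yx)z = y(xz)` are the fixed points of an automorphism, so it suffices to test
  -- `a` and `b`. This is used for `y = a`, for `y = b`, and then, after swapping the outer
  -- arguments, for every `y`.
  have all : ∀ y, (y * x) * a = y * (x * a) → (y * x) * b = y * (x * b) →
      ∀ z, (y * x) * z = y * (x * z) := by
    intro y h1 h2 z
    rcases hQ z with h | h | h | h <;> refine hn.associates_of_modEq h ?_
    · rw [Loop.mul_one, Loop.mul_one]
    · exact h1
    · exact h2
    · exact ha.associates_mul h1 h2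
  have h1 := all a (hc.flexible x a) h
  have h2 := all b (hc.associates_symm h) (hc.flexible x b)
  exact fun y z => all y (hc.associates_symm (h1 y)) (hc.associates_symm (h2 y)) z

/-- The quotient of a loop by a central involution. -/
def quotientSetoid (hn : IsCentralInvolution n) : Setoid Q where
  r := ModEq n
  iseqv := ⟨fun _ => Or.inl rfl, hn.modEq_symm, hn.modEq_trans⟩

/-- The product of the quotient of a loop by a central involution. -/
def quotientMul (hn : IsCentralInvolution n) :
    Quotient hn.quotientSetoid → Quotient hn.quotientSetoid → Quotient hn.quotientSetoid :=
  Quotient.map₂ (· * ·) fun _ _ h _ _ h' => hn.modEq_mul h h'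

theorem quotientMul_mk (hn : IsCentralInvolution n) (x y : Q) :
    hn.quotientMul (Quotient.mk _ x) (Quotient.mk _ y) = Quotient.mk _ (x * y) := rfl

theorem mk_eq_mk (hn : IsCentralInvolution n) {x y : Q} :
    (Quotient.mk hn.quotientSetoid x = Quotient.mk hn.quotientSetoid y) ↔ ModEq n x y :=
  Quotient.eq

theorem quotientMul_comm (hn : IsCentralInvolution n) (hc : IsCommutative Q)
    (p q : Quotient hn.quotientSetoid) : hn.quotientMul p q = hn.quotientMul q p := by
  induction p, q using Quotient.inductionOn₂ with
  | _ x y => rw [quotientMul_mk, quotientMul_mk, hc]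

theorem quotientMul_one (hn : IsCentralInvolution n) (p : Quotient hn.quotientSetoid) :
    hn.quotientMul p (Quotient.mk _ 1) = p := by
  induction p using Quotient.inductionOn with
  | _ x => rw [quotientMul_mk, Loop.mul_one]

theorem quotientMul_cancel (hn : IsCentralInvolution n) (p q r : Quotient hn.quotientSetoid)
    (h : hn.quotientMul p q = hn.quotientMul p r) : q = r := by
  induction p using Quotient.inductionOn with
  | _ x =>
    induction q, r using Quotient.inductionOn₂ with
    | _ y z => exact hn.mk_eq_mk.2 (hn.modEq_cancel (hn.mk_eq_mk.1 h))

end IsCentralInvolution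

/-- The Latin square of order four is forced: `aa = b` gives `ac = e`, `ab = c`, then `bc = a`,
which leaves `e` for `bb`. -/
theorem square_of_square_eq_one {K : Type*} {f : K → K → K} {e a b c : K}
    (hc : ∀ x y, f x y = f y x) (he : ∀ x, f x e = x) (hf : ∀ x y z, f x y = f x z → y = z)
    (hK : ∀ x, x = e ∨ x = a ∨ x = b ∨ x = c) (ha : a ≠ e) (hb : b ≠ e)
    (hce : c ≠ e) (hca : c ≠ a) (hcb : c ≠ b) (hb' : f a a = b) : f b b = e := by
  have hab : a ≠ b := fun h => ha (hf a a e (by rw [hb', he, h]))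
  have hea := he a
  have heb := he b
  have hec := he c
  have hac : f a c = e := by
    rcases hK (f a c) with h | h | h | h <;> grind
  have hab' : f a b = c := by
    rcases hK (f a b) with h | h | h | h <;> grind
  have hbc : f b c = a := by
    rcases hK (f b c) with h | h | h | h <;> grind
  rcases hK (f b b) with h | h | h | h <;> grind

/-- Multiplication by `a` swaps `e` with `a` and `b` with `c`, so products within `{b, c}` lie in
`{e, a}`. Cancellation makes `bb` and `cc` both the value other than `bc`, namely `(bc)a`. -/
theorem cube_of_square_eq_one {K : Type*} {f : K → K → K} {e a b c : K}
    (hc : ∀ x y, f x y = f y x) (he : ∀ x, f x e = x) (hf : ∀ x y z, f x y = f x z → y = z)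
    (hK : ∀ x, x = e ∨ x = a ∨ x = b ∨ x = c) (ha : a ≠ e) (hb : b ≠ e) (hba : b ≠ a)
    (ha' : f a a = e) (hc' : f a b = c) :
    f (f b c) a = f c c ∧ f (f c a) b = f c c := by
  have hce : c ≠ e := fun h => hba (hf a b a (by rw [hc', h, ha']))
  have hca : c ≠ a := fun h => hb (hf a b e (by rw [hc', h, he]))
  have hcb : c ≠ b := fun h => ha (hf b a e (by rw [hc, hc', h, he]))
  have hea := he a
  have heb := he b
  have hec := he c
  have hac : f c a = b := by
    rw [hc]
    rcases hK (f a c) with h | h | h | h <;> grind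
  rw [hac]
  have hbc : f b c = e ∨ f b c = a := by
    rcases hK (f b c) with h | h | h | h <;> grind
  have hbb : f b b = e ∨ f b b = a := by
    rcases hK (f b b) with h | h | h | h <;> grind
  have hcc : f c c = e ∨ f c c = a := by
    rcases hK (f c c) with h | h | h | h <;> grind
  rcases hbc with h1 | h1 <;> rcases hbb with h2 | h2 <;> rcases hcc with h3 | h3 <;> grind

namespace IsCentralInvolution

variable {n : Q}

theorem modEq_of_card_eq_eight (hn : IsCentralInvolution n) (hQ : Nat.card Q = 8) {a b c : Q}
    (ha : ¬ ModEq n a 1) (hb : ¬ ModEq n b 1) (hba : ¬ ModEq n b a) (hc : ¬ ModEq n c 1)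
    (hca : ¬ ModEq n c a) (hcb : ¬ ModEq n c b) (q : Q) :
    ModEq n q 1 ∨ ModEq n q a ∨ ModEq n q b ∨ ModEq n q c := by
  classical
  have : Finite Q := Nat.finite_of_card_ne_zero (by omega)
  have hs : ∀ {x y : Q}, ¬ ModEq n x y → ¬ ModEq n y x := fun h h' => h (hn.modEq_symm h')
  have ne : ∀ {x y : Q}, ¬ ModEq n x y → y ≠ x := fun h h' => h (Or.inl h'.symm)
  obtain ⟨s, hs, h⟩ := hn.exists_modEq {1, a, b, c}
    (by simp [ha, hb, hba, hc, hca, hcb, hs ha, hs hb, hs hba, hs hc, hs hca, hs hcb])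
    (by
      rw [hQ, Finset.card_insert_of_notMem, Finset.card_insert_of_notMem, Finset.card_pair]
      · exact ne hcb
      · simp [ne hba, ne hca]
      · simp [ne ha, ne hb, ne hc]) q
  simp only [Finset.mem_insert, Finset.mem_singleton] at hs
  rcases hs with rfl | rfl | rfl | rfl <;> simp [h]

/-- A loop of order eight with a central involution has an involution modulo the central one. -/
theorem exists_involution_mod (hn : IsCentralInvolution n) (hc : IsCommutative Q)
    (hQ : Nat.card Q = 8) : ∃ a : Q, ¬ ModEq n a 1 ∧ ModEq n (a * a) 1 := by
  classical
  have : Finite Q := Nat.finite_of_card_ne_zero (by omega)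
  obtain ⟨a, ha⟩ := exists_not_modEq n {1} (by simp [hQ])
  replace ha : ¬ ModEq n a 1 := by simpa using ha
  by_cases hb : ModEq n (a * a) 1
  · exact ⟨a, ha, hb⟩
  refine ⟨a * a, hb, ?_⟩
  have hba : ¬ ModEq n (a * a) a := fun h =>
    ha (hn.modEq_cancel (x := a) (by rwa [Loop.mul_one]))
  obtain ⟨c, hcc⟩ := exists_not_modEq n {1, a, a * a} (by
    rw [hQ]
    have := Finset.card_le_three (a := (1 : Q)) (b := a) (c := a * a)
    omega)
  simp only [Finset.mem_insert, Finset.mem_singleton, forall_eq_or_imp, forall_eq] at hcc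
  obtain ⟨hc1, hca, hcb⟩ := hcc
  have hK := hn.modEq_of_card_eq_eight hQ ha hb hba hc1 hca hcb
  rw [← hn.mk_eq_mk, ← hn.quotientMul_mk]
  simp only [← hn.mk_eq_mk] at ha hb hc1 hca hcb hK
  exact square_of_square_eq_one (hn.quotientMul_comm hc) hn.quotientMul_one
    hn.quotientMul_cancel (fun x => Quotient.inductionOn x hK) ha hb hc1 hca hcb
    (hn.quotientMul_mk a a)

/-- A commutative A-loop of order eight with a central involution `n` has a further element in
its middle nucleus. -/
theorem exists_mem_middleNucleus_of_card_eq_eight (hn : IsCentralInvolution n)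
    (hc : IsCommutative Q) (hA : IsAutomorphic Q) (hQ : Nat.card Q = 8) :
    ∃ x ∈ middleNucleus Q, ¬ ModEq n x 1 := by
  classical
  by_contra! hN
  have : Finite Q := Nat.finite_of_card_ne_zero (by omega)
  obtain ⟨a, ha, haa⟩ := hn.exists_involution_mod hc hQ
  obtain ⟨b, hb⟩ := exists_not_modEq n {1, a} (by
    rw [hQ]
    have := Finset.card_le_two (a := (1 : Q)) (b := a)
    omega)
  simp only [Finset.mem_insert, Finset.mem_singleton, forall_eq_or_imp, forall_eq] at hb
  obtain ⟨hb, hba⟩ := hb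
  have hc1 : ¬ ModEq n (a * b) 1 := fun h =>
    hba (hn.modEq_cancel (hn.modEq_trans h (hn.modEq_symm haa)))
  have hca : ¬ ModEq n (a * b) a := fun h =>
    hb (hn.modEq_cancel (x := a) (by rwa [Loop.mul_one]))
  have hcb : ¬ ModEq n (a * b) b := fun h =>
    ha (hn.modEq_cancel (x := b) (by rwa [Loop.mul_one, hc]))
  have hK := hn.modEq_of_card_eq_eight hQ ha hb hba hc1 hca hcb
  have key : ∀ x, ¬ ModEq n x 1 → (a * x) * b ≠ a * (x * b) := fun x hx h =>
    hx (hN x (hn.mem_middleNucleus_of_associates hc hA hK h))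
  -- Each equality, after cancelling a factor that associates by flexibility where needed, says that
  -- `b`, `a` or `ab` respectively associates between `a` and `b`, and so lies in the middle
  -- nucleus.
  have h12 : (a * b) * (a * b) ≠ (b * (a * b)) * a := fun h =>
    key b hb (hA.associates_of_mul (hc.flexible b a) (h.trans (hc _ _)))
  have h13 : (a * b) * (a * b) ≠ ((a * b) * a) * b := fun h =>
    key a ha (hc.associates_symm (hA.associates_of_mul (hc.flexible a b) (by
      rw [hc b a, h, hc _ b, hc (a * b) a])))
  have h23 : (b * (a * b)) * a ≠ ((a * b) * a) * b := fun h =>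
    key (a * b) hc1 (by rw [hc a (a * b), ← h, hc _ a, hc b (a * b)])
  -- Three elements in one class of size two: by pigeonhole two are equal.
  have hcube : ModEq n ((b * (a * b)) * a) ((a * b) * (a * b)) ∧
      ModEq n (((a * b) * a) * b) ((a * b) * (a * b)) := by
    simp only [← hn.mk_eq_mk] at ha hb hba haa hK ⊢
    exact cube_of_square_eq_one (hn.quotientMul_comm hc) hn.quotientMul_one
      hn.quotientMul_cancel (fun x => Quotient.inductionOn x hK) ha hb hba haa
      (hn.quotientMul_mk a b)
  obtain ⟨h1 | h1, h2 | h2⟩ := hcube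
  · exact h12 h1.symm
  · exact h12 h1.symm
  · exact h13 h2.symm
  · exact h23 (h1.trans h2.symm)

end IsCentralInvolution

theorem IsCommutative.isAssociative_of_card_le_eight (hc : IsCommutative Q)
    (ha : IsAutomorphic Q) (h : Nat.card (middleNucleus Q) = 2)
    (hQ : Nat.card Q = 4 ∨ Nat.card Q = 8) : IsAssociative Q := by
  obtain ⟨n, hn, hN⟩ := exists_isCentralInvolution hc ha h
  rcases hQ with hQ | hQ
  · exact hn.isAssociative_of_card_eq_four hc hQ
  · obtain ⟨x, hx, hx1⟩ := hn.exists_mem_middleNucleus_of_card_eq_eight hc ha hQ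
    exact absurd ((hN x hx).imp_right fun h => h.trans (Loop.mul_one n).symm) hx1

end SmallMiddleNucleus

/-! ### Central extensions by symmetric cocycles -/

/-- The underlying set of the central extension of `V` by `A` with cocycle `θ`. -/
structure CocycleExtension {V A : Type} (θ : V → V → A) : Type u where
  base : V
  fiber : A

namespace CocycleExtension

theorem ext' {V A : Type} {θ : V → V → A} {p q : CocycleExtension.{u} θ} (h : p.base = q.base) (h' : p.fiber = q.fiber) :
    p = q := by
  cases p
  cases q
  simp_all

variable {V A : Type} [AddCommGroup V] [AddCommGroup A] {θ : V → V → A}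

/-- The elements of a central extension are pairs. -/
def equivProd (θ : V → V → A) : CocycleExtension.{u} θ ≃ V × A where
  toFun p := (p.base, p.fiber)
  invFun p := ⟨p.1, p.2⟩
  left_inv _ := rfl
  right_inv _ := rfl

/-- The loop structure on a central extension by a normalized symmetric cocycle. -/
@[reducible]
def loop (hθ : ∀ x y, θ x y = θ y x) (h0 : ∀ x, θ x 0 = 0) : Loop (CocycleExtension.{u} θ) :=
  have hc : ∀ p q : CocycleExtension.{u} θ,
      (⟨p.base + q.base, p.fiber + q.fiber + θ p.base q.base⟩ : CocycleExtension.{u} θ) =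
        ⟨q.base + p.base, q.fiber + p.fiber + θ q.base p.base⟩ := fun p q => by
    rw [hθ, add_comm p.base, add_comm p.fiber]
  have hb : ∀ p : CocycleExtension.{u} θ, Function.Bijective fun q : CocycleExtension.{u} θ =>
      (⟨p.base + q.base, p.fiber + q.fiber + θ p.base q.base⟩ : CocycleExtension.{u} θ) := by
    refine fun p => ⟨fun q r h => ?_, fun q => ?_⟩
    · simp only [CocycleExtension.mk.injEq, add_right_inj] at h
      obtain ⟨h1, h2⟩ := h
      rw [h1] at h2
      exact ext' h1 (by simpa using h2)
    · exact ⟨⟨q.base - p.base, q.fiber - p.fiber - θ p.base (q.base - p.base)⟩,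
        ext' (by simp) (by dsimp only; abel)⟩
  { mul := fun p q => ⟨p.base + q.base, p.fiber + q.fiber + θ p.base q.base⟩
    one := ⟨0, 0⟩
    one_mul := fun p => ext' (zero_add p.base)
      (show 0 + p.fiber + θ 0 p.base = p.fiber by rw [hθ, h0, zero_add, add_zero])
    mul_one := fun p => ext' (add_zero p.base)
      (show p.fiber + 0 + θ p.base 0 = p.fiber by rw [h0, add_zero, add_zero])
    bijective_mul_left := hb
    bijective_mul_right := fun p => by
      convert hb p using 2 with q
      exact hc q p }

/-- The associator of a cocycle. -/
def associator (θ : V → V → A) (x y z : V) : A :=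
  θ x y + θ (x + y) z - θ y z - θ x (y + z)

variable (hθ : ∀ x y, θ x y = θ y x) (h0 : ∀ x, θ x 0 = 0)

theorem isCommutative_loop :
    @IsCommutative (CocycleExtension.{u} θ) (loop hθ h0) := fun p q =>
  ext' (add_comm _ _)
    (show p.fiber + q.fiber + θ p.base q.base = q.fiber + p.fiber + θ q.base p.base by
      rw [hθ, add_comm p.fiber])

theorem isAutomorphic_loop
    (hadd : ∀ x y z w, associator θ x y (z + w) = associator θ x y z + associator θ x y w) :
    @IsAutomorphic (CocycleExtension.{u} θ) (loop hθ h0) := by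
  let := loop.{u} hθ h0
  refine isAutomorphic_of_commutative (isCommutative_loop hθ h0) ?_
  -- Inner mappings fix the base and shift the fiber by minus the associator, so additivity of the
  -- shift is what makes them homomorphisms.
  have key : ∀ p q r : CocycleExtension.{u} θ, leftInner p q r =
      ⟨r.base, r.fiber - associator θ q.base p.base r.base⟩ := fun p q r => by
    refine mul_left_cancel (x := q * p) ((leftInner_spec p q r).trans
      (ext' (add_assoc _ _ _).symm ?_))
    change q.fiber + (p.fiber + r.fiber + θ p.base r.base) + θ q.base (p.base + r.base) =
      q.fiber + p.fiber + θ q.base p.base + (r.fiber - associator θ q.base p.base r.base) +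
        θ (q.base + p.base) r.base
    rw [associator]
    abel
  intro p q r s
  rw [key, key, key]
  refine ext' rfl ?_
  change r.fiber + s.fiber + θ r.base s.base - associator θ q.base p.base (r.base + s.base) =
    r.fiber - associator θ q.base p.base r.base + (s.fiber - associator θ q.base p.base s.base) +
      θ r.base s.base
  rw [hadd]
  abel

theorem mem_middleNucleus_loop (q : CocycleExtension.{u} θ) :
    q ∈ @middleNucleus (CocycleExtension.{u} θ) (loop hθ h0) ↔
      ∀ x z, associator θ x q.base z = 0 := by
  let := loop.{u} hθ h0
  have key : ∀ p r : CocycleExtension.{u} θ, (p * q) * r = p * (q * r) ↔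
      associator θ p.base q.base r.base = 0 := fun p r => by
    have h : ((p * q) * r).fiber - (p * (q * r)).fiber =
        associator θ p.base q.base r.base := by
      change p.fiber + q.fiber + θ p.base q.base + r.fiber + θ (p.base + q.base) r.base -
        (p.fiber + (q.fiber + r.fiber + θ q.base r.base) + θ p.base (q.base + r.base)) =
          associator θ p.base q.base r.base
      rw [associator]
      abel
    rw [← h, sub_eq_zero]
    exact ⟨fun h => congrArg _ h, fun h => ext' (add_assoc _ _ _) h⟩
  exact ⟨fun h x z => (key ⟨x, 0⟩ ⟨z, 0⟩).1 (h _ _), fun h p r => (key p r).2 (h _ _)⟩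

theorem card_middleNucleus_loop :
    Nat.card (@middleNucleus (CocycleExtension.{u} θ) (loop hθ h0)) =
      Nat.card {y : V // ∀ x z, associator θ x y z = 0} * Nat.card A := by
  rw [← Nat.card_prod]
  exact Nat.card_congr
    { toFun := fun q => (⟨q.1.base, (mem_middleNucleus_loop hθ h0 q.1).1 q.2⟩, q.1.fiber)
      invFun := fun p => ⟨⟨p.1.1, p.2⟩, (mem_middleNucleus_loop hθ h0 _).2 p.1.2⟩
      left_inv := fun _ => rfl
      right_inv := fun _ => rfl }

end CocycleExtension

/-! ### Cubic cocycles over 𝔽₂ and the examples -/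

section CubicCocycle

variable {m n : ℕ} [NeZero m]

/-- The cocycle `θ(x, y) = ∑ i, x i * y i * (x (i + 1) + y (i + 1)) • c i` on `𝔽₂ᵐ`. -/
def cubicCocycle (c : Fin m → Fin n → ZMod 2) (x y : Fin m → ZMod 2) : Fin n → ZMod 2 :=
  ∑ i, (x i * y i * (x (i + 1) + y (i + 1))) • c i

theorem cubicCocycle_comm (c : Fin m → Fin n → ZMod 2) (x y : Fin m → ZMod 2) :
    cubicCocycle c x y = cubicCocycle c y x :=
  Finset.sum_congr rfl fun i _ => by rw [mul_comm (x i), add_comm (x (i + 1))]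

theorem cubicCocycle_zero (c : Fin m → Fin n → ZMod 2) (x : Fin m → ZMod 2) :
    cubicCocycle c x 0 = 0 := by
  simp [cubicCocycle]

theorem associator_cubicCocycle (c : Fin m → Fin n → ZMod 2) (x y z : Fin m → ZMod 2) :
    CocycleExtension.associator (cubicCocycle c) x y z =
      ∑ i, (y i * (x i * z (i + 1) + x (i + 1) * z i)) • c i := by
  simp only [CocycleExtension.associator, cubicCocycle, ← Finset.sum_add_distrib,
    ← Finset.sum_sub_distrib, ← add_smul, ← sub_smul, Pi.add_apply]
  refine Finset.sum_congr rfl fun i _ => congrArg (· • c i) ?_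
  have key : ∀ p q r p' q' r' : ZMod 2,
      p * q * (p' + q') + (p + q) * r * (p' + q' + r') - q * r * (q' + r') -
        p * (q + r) * (p' + (q' + r')) = q * (p * r' + p' * r) := by
    decide
  exact key _ _ _ _ _ _

/-- Reduces an example to counting the radical: a radical of order `2 ^ r` gives a middle nucleus of
order `2 ^ (r + n)`. Nonassociativity follows from `l < k`. -/
theorem exists_loop_of_cubicCocycle (c : Fin m → Fin n → ZMod 2) {k l r : ℕ}
    (hk : m + n = k) (hl : r + n = l) (hlt : l < k)
    (hr : Nat.card {y : Fin m → ZMod 2 // ∀ x z : Fin m → ZMod 2,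
      ∑ i, (y i * (x i * z (i + 1) + x (i + 1) * z i)) • c i = 0} = 2 ^ r) :
    ∃ (Q : Type u) (_ : Loop Q), IsCommutative Q ∧ IsAutomorphic Q ∧ ¬ IsAssociative Q ∧
      Nat.card Q = 2 ^ k ∧ Nat.card (middleNucleus Q) = 2 ^ l := by
  let := CocycleExtension.loop.{u} (cubicCocycle_comm c) (cubicCocycle_zero c)
  have hQ : Nat.card (CocycleExtension.{u} (cubicCocycle c)) = 2 ^ k := by
    rw [Nat.card_congr (CocycleExtension.equivProd _), Nat.card_prod, ← hk, pow_add]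
    simp
  have hN : Nat.card (middleNucleus (CocycleExtension.{u} (cubicCocycle c))) = 2 ^ l := by
    rw [CocycleExtension.card_middleNucleus_loop, ← hl, pow_add, ← hr]
    simp [associator_cubicCocycle]
  refine ⟨_, this, CocycleExtension.isCommutative_loop (cubicCocycle_comm c) (cubicCocycle_zero c),
    CocycleExtension.isAutomorphic_loop (cubicCocycle_comm c) (cubicCocycle_zero c) fun x y z w => ?_, fun h => ?_, hQ, hN⟩
  · simp only [associator_cubicCocycle, ← Finset.sum_add_distrib, ← add_smul, Pi.add_apply]
    refine Finset.sum_congr rfl fun i _ => congrArg (· • c i) ?_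
    ring
  · rw [isAssociative_iff_middleNucleus.1 h, Nat.card_congr (Equiv.Set.univ _), hQ] at hN
    exact hlt.ne' (Nat.pow_right_injective le_rfl hN)

/-- Testing the form of `associator_cubicCocycle` on two standard basis vectors. -/
theorem sum_single_smul (c : Fin m → Fin n → ZMod 2) (y : Fin m → ZMod 2) (j : Fin m)
    (hj : j + 1 ≠ j) (hj' : j + 1 + 1 ≠ j) :
    ∑ i, (y i * ((Pi.single j 1 : Fin m → ZMod 2) i *
      (Pi.single (j + 1) 1 : Fin m → ZMod 2) (i + 1) +
        (Pi.single j 1 : Fin m → ZMod 2) (i + 1) *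
          (Pi.single (j + 1) 1 : Fin m → ZMod 2) i)) • c i = y j • c j := by
  rw [Finset.sum_eq_single j]
  · simp [hj, hj.symm]
  · intro i _ hi
    -- The index `j + 1` could contribute only through `j + 1 + 1 = j`, which `hj'` excludes.
    by_cases h : i = j + 1
    · subst h
      simp [hi, hj']
    · simp [hi, h]
  · simp

end CubicCocycle

theorem exists_loop_of_three_le {k l : ℕ} (hl : 0 < l) (hkl : 3 ≤ k - l) :
    ∃ (Q : Type u) (_ : Loop Q), IsCommutative Q ∧ IsAutomorphic Q ∧ ¬ IsAssociative Q ∧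
      Nat.card Q = 2 ^ k ∧ Nat.card (middleNucleus Q) = 2 ^ l := by
  obtain ⟨d, hd⟩ : ∃ d, k = d + 3 + l := ⟨k - l - 3, by omega⟩
  have h1 : ∀ j : Fin (d + 3), j + 1 ≠ j := fun j => by simp
  -- Dimension at least three is needed here: in dimension two both indices give the same form in
  -- `x` and `z`, so a constant `c` would detect only `y 0 + y 1`.
  have h2 : ∀ j : Fin (d + 3), j + 1 + 1 ≠ j := fun j h => by
    rw [add_assoc, add_eq_left] at h
    simp [Fin.ext_iff, Fin.val_add, Nat.mod_eq_of_lt (show 2 < d + 3 by omega)] at h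
  refine exists_loop_of_cubicCocycle (m := d + 3) (n := l) (r := 0) (fun _ _ => 1) hd.symm
    (zero_add l) (by omega) ?_
  rw [pow_zero, Nat.card_eq_one_iff_unique]
  refine ⟨⟨?_⟩, ⟨⟨0, by simp⟩⟩⟩
  suffices h : ∀ y : {y : Fin (d + 3) → ZMod 2 // _}, y.1 = 0 from
    fun y z => Subtype.ext ((h y).trans (h z).symm)
  rintro ⟨y, hy⟩
  funext j
  have := congrFun (hy (Pi.single j 1) (Pi.single (j + 1) 1)) ⟨0, hl⟩
  rw [sum_single_smul _ y j (h1 j) (h2 j)] at this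
  simpa using this

theorem exists_loop_of_index_four {l : ℕ} (hl : 2 ≤ l) :
    ∃ (Q : Type u) (_ : Loop Q), IsCommutative Q ∧ IsAutomorphic Q ∧ ¬ IsAssociative Q ∧
      Nat.card Q = 2 ^ (l + 2) ∧ Nat.card (middleNucleus Q) = 2 ^ l := by
  -- Two independent vectors `c 0`, `c 1` detect `y 0` and `y 1` separately; they exist since `2 ≤
  -- l`.
  refine exists_loop_of_cubicCocycle (m := 2) (n := l) (r := 0)
    ![Pi.single ⟨0, by omega⟩ 1, Pi.single ⟨1, by omega⟩ 1] (add_comm _ _)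
    (zero_add l) (by omega) ?_
  rw [pow_zero, Nat.card_eq_one_iff_unique]
  refine ⟨⟨?_⟩, ⟨⟨0, by simp⟩⟩⟩
  suffices h : ∀ y : {y : Fin 2 → ZMod 2 // _}, y.1 = 0 from
    fun y z => Subtype.ext ((h y).trans (h z).symm)
  rintro ⟨y, hy⟩
  have h := hy ![1, 0] ![0, 1]
  simp only [Fin.sum_univ_two] at h
  have h0 := congrFun h ⟨0, by omega⟩
  have h1 := congrFun h ⟨1, by omega⟩
  funext j
  fin_cases j
  · simpa using h0
  · simpa using h1

theorem exists_loop_of_index_two {l : ℕ} (hl : 2 ≤ l) :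
    ∃ (Q : Type u) (_ : Loop Q), IsCommutative Q ∧ IsAutomorphic Q ∧ ¬ IsAssociative Q ∧
      Nat.card Q = 2 ^ (l + 1) ∧ Nat.card (middleNucleus Q) = 2 ^ l := by
  -- With `c 1 = 0` the radical is the line `y 0 = 0`, which supplies one factor 2 of the middle
  -- nucleus. The fiber supplies the other `l - 1`, and it must be nonzero for `c 0 ≠ 0`, so `2 ≤
  -- l`.
  refine exists_loop_of_cubicCocycle (m := 2) (n := l - 1) (r := 1)
    ![fun _ => 1, 0] (by omega) (by omega) (by omega) ?_
  have h : ∀ y : Fin 2 → ZMod 2, (∀ x z : Fin 2 → ZMod 2,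
      ∑ i, (y i * (x i * z (i + 1) + x (i + 1) * z i)) •
        (![fun _ => 1, 0] : Fin 2 → Fin (l - 1) → ZMod 2) i = 0) ↔ y 0 = 0 := by
    refine fun y => ⟨fun h => ?_, fun h x z => by simp [Fin.sum_univ_two, h]⟩
    have h0 := congrFun (h ![1, 0] ![0, 1]) ⟨0, by omega⟩
    simpa [Fin.sum_univ_two] using h0
  rw [Nat.card_congr (Equiv.subtypeEquivRight h), Nat.card_eq_fintype_card]
  decide

end Loop

theorem mainTheorem6 (k l : ℕ) (hl : 0 < l) (hkl : l ≤ k) :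
    (∃ (Q : Type u) (_ : Loop Q),
        Loop.IsCommutative Q ∧ Loop.IsAutomorphic Q ∧ ¬ Loop.IsAssociative Q ∧
          Nat.card Q = 2 ^ k ∧ Nat.card (Loop.middleNucleus Q) = 2 ^ l) ↔
      (3 ≤ k - l ∨ (1 ≤ k - l ∧ 2 ≤ l)) := by
  constructor
  · rintro ⟨Q, _, hc, ha, hna, hQ, hN⟩
    by_contra hcon
    have : Finite Q := Nat.finite_of_card_ne_zero (by simp [hQ])
    rcases hkl.eq_or_lt with rfl | hlt
    · refine hna (Loop.isAssociative_iff_middleNucleus.2 ?_)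
      exact Set.eq_of_subset_of_ncard_le (Set.subset_univ _)
        (by rw [Set.ncard_univ, hQ, ← Nat.card_coe_set_eq, hN])
    · obtain rfl : l = 1 := by omega
      refine hna (hc.isAssociative_of_card_le_eight ha hN ?_)
      obtain rfl | rfl : k = 2 ∨ k = 3 := by omega
      · exact Or.inl hQ
      · exact Or.inr hQ
  · intro h
    by_cases h3 : 3 ≤ k - l
    · exact Loop.exists_loop_of_three_le hl h3
    · obtain rfl | rfl : k = l + 1 ∨ k = l + 2 := by omega
      · exact Loop.exists_loop_of_index_two (by omega)
      · exact Loop.exists_loop_of_index_four (by omega)
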